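/- Conventions. For a metric space $X$ with Borel $\sigma$-algebra $\mathcal B(X)$, a \emph{charge} on $X$ is a finitely additive probability measure on $\mathcal B(X)$. For a bounded metric space $(X,d)$ the Wasserstein distance between two charges is $$W(\mu,\nu)=\sup\Big\{\Big|\int f\,d\mu-\int f\,d\nu\Big| : f:X\to\mathbb R,\ |f(x)-f(y)|\le d(x,y)\text{ for all }x,y\Big\}.$$ Work in a countably saturated nonstandard extension. An \emph{internal probability measure} $\nu$ on $({}^*X,{}^*\mathcal B(X))$ is an element of the star of the set of charges on $X$. Its \emph{internal push-down} is the charge $\nu_{ip}(A)=\mathsf{st}(\nu({}^*A))$, $A\in\mathcal B(X)$. Its \emph{external push-down} is $\nu_p(C)=\overline\nu(\mathsf{st}^{-1}(C))$, defined for those $C\subseteq X$ for which $\mathsf{st}^{-1}(C)$ is Loeb measurable; here $\overline\nu$ is the Loeb measure of $\nu$ and $\mathsf{st}^{-1}(C)$ is the set of points of ${}^*X$ that lie in the monad of some point of $C$. Theorem. Let $X$ be a bounded $\sigma$-compact metric space. (1) Let $\nu$ be an internal probability measure on $({}^*X,{}^*\mathcal B(X))$, and suppose that $\nu_p$ is a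 countably additive probability measure on $(X,\mathcal B(X))$ (in particular, that it is defined on every Borel set). Then $W(\nu_p,\nu_{ip})=0$. (2) $W$ is a pseudometric on the set of charges on $X$: it is finite and symmetric, it satisfies the triangle inequality, and $W(\mu,\mu)=0$ for every charge $\mu$. (3) If $X$ has a non-isolated point, then $W$ is not a metric on the charges: there are charges $\mu\ne\nu$ on $X$ with $W(\mu,\nu)=0$. In fact, in every countably saturated nonstandard extension there is an internal probability measure $\nu$ on $({}^*X,{}^*\mathcal B(X))$ such that $\nu_p$ is a countably additive probability measure on $(X,\mathcal B(X))$ and $\nu_p\ne\nu_{ip}$. -/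

import Mathlib

open MeasureTheory Set Filter Topology
open scoped ENNReal

noncomputable section

/-! ### Charges, integration and the Wasserstein distance -/

/-- The measurable subsets of `X`; for a metric space with `BorelSpace`, its Borel sets. -/
abbrev BorelSets (X : Type*) [MeasurableSpace X] : Type _ := {A : Set X // MeasurableSet A}

/-- A charge: a finitely additive probability measure on the measurable sets. -/
@[ext]
structure Charge (X : Type*) [MeasurableSpace X] where
  toFun : BorelSets X → ℝ
  nonneg : ∀ A, 0 ≤ toFun A
  map_empty : toFun ⟨∅, MeasurableSet.empty⟩ = 0
  map_univ : toFun ⟨univ, MeasurableSet.univ⟩ = 1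
  map_union : ∀ A B : BorelSets X, Disjoint A.1 B.1 →
    toFun ⟨A.1 ∪ B.1, A.2.union B.2⟩ = toFun A + toFun B

namespace Charge

variable {X : Type*} [MeasurableSpace X]

/-- A countably additive probability measure, regarded as a charge. -/
def ofMeasure (P : Measure X) [IsProbabilityMeasure P] : Charge X where
  toFun A := P.real A.1
  nonneg A := measureReal_nonneg
  map_empty := by simp
  map_univ := by simp
  map_union A B h := measureReal_union h B.2

/-- The integral of a simple function against a charge. -/
def simpleIntegral (P : Charge X) (s : SimpleFunc X ℝ) : ℝ :=
  ∑ y ∈ s.range, y * P.toFun ⟨s ⁻¹' {y}, s.measurableSet_fiber y⟩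

/-- The integral of a bounded measurable function against a charge: the supremum of the integrals
of the simple functions below it. (Bounded measurable functions are uniform limits of simple
functions, so this supremum is also the infimum of the integrals of the simple functions
above.) -/
def integral (P : Charge X) (f : X → ℝ) : ℝ :=
  sSup {I : ℝ | ∃ s : SimpleFunc X ℝ, (∀ x, s x ≤ f x) ∧ I = P.simpleIntegral s}

end Charge

/-- The Wasserstein distance between two charges on a bounded metric space. -/
def wasserstein {X : Type*} [MetricSpace X] [MeasurableSpace X] (μ ν : Charge X) : ℝ≥0∞ :=
  ⨆ (f : X → ℝ) (_ : LipschitzWith 1 f), ENNReal.ofReal |μ.integral f - ν.integral f|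

/-! ### Nonstandard extensions -/

/-- The full first-order language of a set `U`: every finitary function and relation on `U` has
a name. -/
def fullLanguage (U : Type*) : FirstOrder.Language where
  Functions n := (Fin n → U) → U
  Relations n := Set (Fin n → U)

/-- The name of a function on `U`. -/
def functionSymbol {U : Type*} {n : ℕ} (f : (Fin n → U) → U) : (fullLanguage U).Functions n := f

/-- The name of a relation on `U`. -/
def relationSymbol {U : Type*} {n : ℕ} (R : Set (Fin n → U)) : (fullLanguage U).Relations n := R

/-- In `U` itself, every symbol denotes the function or relation that it names. -/
instance fullStructure (U : Type*) : (fullLanguage U).Structure U where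
  funMap {n} (f : (Fin n → U) → U) x := f x
  RelMap {n} (R : Set (Fin n → U)) x := x ∈ R

/-- `R a₁ … aₙ` in an extension: the star of the relation `R` on `U`. -/
def starRelation {U M : Type*} [(fullLanguage U).Structure M] {n : ℕ} (R : Set (Fin n → U))
    (a : Fin n → M) : Prop :=
  FirstOrder.Language.Structure.RelMap (relationSymbol R) a

/-- `f a₁ … aₙ` in an extension: the star of the function `f` on `U`. -/
def starFunction {U M : Type*} [(fullLanguage U).Structure M] {n : ℕ} (f : (Fin n → U) → U)
    (a : Fin n → M) : M :=
  FirstOrder.Language.Structure.funMap (functionSymbol f) a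

/-- A countably saturated nonstandard extension `*U` of a set `U`.
* Extension and transfer: `U` embeds in `*U`, every relation `R` and function `f` on `U` has an
  extension `*R`, `*f` to `*U`, and every first-order statement about elements, relations and
  functions of `U` is true in `U` if and only if it is true in `*U`.
* Saturation: a sequence of internal sets with the finite intersection property has a common
  element. The internal sets are the sections `{a | *R a p}` with `p ∈ *U`. (If `U` is infinite,
  further parameters give no further sets, and saturation makes `*U` a proper extension.) -/
structure NonstandardExtension (U : Type*) where
  carrier : Type*
  [str : (fullLanguage U).Structure carrier]
  emb : FirstOrder.Language.ElementaryEmbedding (fullLanguage U) U carrier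
  saturated : ∀ s : ℕ → Set carrier,
    (∀ n, ∃ (R : Set (Fin 2 → U)) (p : carrier), s n = {a | starRelation R ![a, p]}) →
    (∀ n, (⋂ k ∈ Finset.range n, s k).Nonempty) → (⋂ n, s n).Nonempty

attribute [instance] NonstandardExtension.str

namespace NonstandardExtension

variable {U : Type*} (M : NonstandardExtension U)

/-- The star `*A` of a subset `A` of `U`. -/
def starSet (A : Set U) : Set M.carrier := {a | starRelation {u : Fin 1 → U | u 0 ∈ A} ![a]}

/-- The star of a binary relation on `U`. -/
def starRel (R : U → U → Prop) (a b : M.carrier) : Prop :=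
  starRelation {u : Fin 2 → U | R (u 0) (u 1)} ![a, b]

/-- The star of a binary function on `U`. -/
def starFun (f : U → U → U) (a b : M.carrier) : M.carrier :=
  starFunction (fun u : Fin 2 → U => f (u 0) (u 1)) ![a, b]

end NonstandardExtension

/-! ### Elementary consequences of transfer -/

namespace NonstandardExtension

open FirstOrder FirstOrder.Language

variable {U : Type*} (M : NonstandardExtension U)

theorem transfer_forall {n : ℕ} (φ : (fullLanguage U).Formula (Fin n))
    (h : ∀ u : Fin n → U, φ.Realize u) (a : Fin n → M.carrier) : φ.Realize a := by
  let ψ : (fullLanguage U).Sentence :=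
    Formula.iAlls (L := fullLanguage U) (α := Empty) (Fin n) (φ.relabel Sum.inr)
  have h1 : U ⊨ ψ := by
    refine Formula.realize_iAlls.2 fun i => ?_
    rw [Formula.realize_relabel]
    exact h _
  have h2 := Formula.realize_iAlls.1 ((M.emb.map_sentence ψ).1 h1) a
  rw [Formula.realize_relabel] at h2
  exact h2

/-- The formula `R x₀ … xₙ₋₁`. -/
def relFormula {n : ℕ} (R : Set (Fin n → U)) : (fullLanguage U).Formula (Fin n) :=
  Relations.formula (relationSymbol R) fun i => Term.var i

theorem realize_relFormula {n : ℕ} (R : Set (Fin n → U)) {N : Type*}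
    [(fullLanguage U).Structure N] (a : Fin n → N) :
    (relFormula R).Realize a ↔ starRelation R a := by
  rw [relFormula, Formula.realize_rel]
  exact Iff.rfl

theorem mem_starSet_univ (a : M.carrier) : a ∈ M.starSet univ := by
  have := M.transfer_forall (relFormula {u : Fin 1 → U | u 0 ∈ (univ : Set U)})
    (fun u => (realize_relFormula _ u).2 (mem_univ (u 0))) ![a]
  exact (realize_relFormula _ _).1 this

theorem mem_starSet_inter (A B : Set U) (a : M.carrier) :
    a ∈ M.starSet (A ∩ B) ↔ a ∈ M.starSet A ∧ a ∈ M.starSet B := by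
  have := M.transfer_forall ((relFormula {u : Fin 1 → U | u 0 ∈ A ∩ B}).iff
    (relFormula {u : Fin 1 → U | u 0 ∈ A} ⊓ relFormula {u : Fin 1 → U | u 0 ∈ B}))
    (fun u => by
      rw [Formula.realize_iff, Formula.realize_inf]
      simp only [realize_relFormula]
      exact Iff.rfl) ![a]
  rw [Formula.realize_iff, Formula.realize_inf] at this
  simp only [realize_relFormula] at this
  exact this

theorem mem_starSet_compl (A : Set U) (a : M.carrier) :
    a ∈ M.starSet Aᶜ ↔ a ∉ M.starSet A := by
  have := M.transfer_forall ((relFormula {u : Fin 1 → U | u 0 ∈ Aᶜ}).iff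
    (relFormula {u : Fin 1 → U | u 0 ∈ A}).not)
    (fun u => by
      rw [Formula.realize_iff, Formula.realize_not]
      simp only [realize_relFormula]
      exact Iff.rfl) ![a]
  rw [Formula.realize_iff, Formula.realize_not] at this
  simp only [realize_relFormula] at this
  exact this

theorem mem_starSet_of_subset {A B : Set U} (h : A ⊆ B) {a : M.carrier}
    (ha : a ∈ M.starSet A) : a ∈ M.starSet B := by
  rw [← inter_eq_left.2 h, mem_starSet_inter] at ha
  exact ha.2

theorem emb_mem_starSet (A : Set U) (x : U) : M.emb x ∈ M.starSet A ↔ x ∈ A := by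
  have := M.emb.map_rel (relationSymbol {u : Fin 1 → U | u 0 ∈ A}) ![x]
  have e : (M.emb ∘ ![x]) = ![M.emb x] := by
    funext i
    fin_cases i
    rfl
  rw [e] at this
  exact this

/-- The sets whose star contains `a` form an ultrafilter. -/
def starUltrafilter (a : M.carrier) : Ultrafilter U :=
  Ultrafilter.ofComplNotMemIff
    { sets := {A | a ∈ M.starSet A}
      univ_sets := M.mem_starSet_univ a
      sets_of_superset := fun hA h => M.mem_starSet_of_subset h hA
      inter_sets := fun hA hB => (M.mem_starSet_inter _ _ a).2 ⟨hA, hB⟩ }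
    fun A => not_iff_comm.1 (M.mem_starSet_compl A a).symm

theorem mem_starUltrafilter (a : M.carrier) (A : Set U) :
    A ∈ M.starUltrafilter a ↔ a ∈ M.starSet A := Iff.rfl

/-- The term naming an element. -/
def nameTerm {n : ℕ} (c : U) : (fullLanguage U).Term (Fin n) :=
  Term.func (functionSymbol (n := 0) fun _ => c) Fin.elim0

/-- The variable of a formula in one variable. -/
def varTerm : (fullLanguage U).Term (Fin 1) := Term.var 0

/-- The term `f(s, t)`. -/
def funTerm {n : ℕ} (f : U → U → U) (s t : (fullLanguage U).Term (Fin n)) :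
    (fullLanguage U).Term (Fin n) :=
  Term.func (functionSymbol fun u : Fin 2 → U => f (u 0) (u 1)) ![s, t]

/-- The formula `R(s, t)`. -/
def rel2Formula {n : ℕ} (R : U → U → Prop) (s t : (fullLanguage U).Term (Fin n)) :
    (fullLanguage U).Formula (Fin n) :=
  Relations.formula (relationSymbol {u : Fin 2 → U | R (u 0) (u 1)}) ![s, t]

theorem realize_nameTerm {n : ℕ} (c : U) (a : Fin n → M.carrier) :
    (nameTerm c).realize a = M.emb c := by
  have := M.emb.map_fun (functionSymbol (n := 0) fun _ => c) Fin.elim0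
  rw [nameTerm, Term.realize_func]
  refine Eq.trans ?_ this.symm
  congr 1
  funext i
  exact i.elim0

theorem realize_rel2Formula {n : ℕ} (R : U → U → Prop) (s t : (fullLanguage U).Term (Fin n))
    (a : Fin n → M.carrier) :
    (rel2Formula R s t).Realize a ↔ M.starRel R (s.realize a) (t.realize a) := by
  rw [rel2Formula, Formula.realize_rel, starRel, starRelation]
  have : (fun i => Term.realize a (![s, t] i)) = ![s.realize a, t.realize a] := by
    funext i
    fin_cases i <;> rfl
  rw [this]

theorem realize_funTerm {n : ℕ} (f : U → U → U) (s t : (fullLanguage U).Term (Fin n))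
    (a : Fin n → M.carrier) :
    (funTerm f s t).realize a = M.starFun f (s.realize a) (t.realize a) := by
  rw [funTerm, Term.realize_func, starFun, starFunction]
  have : (fun i => Term.realize a (![s, t] i)) = ![s.realize a, t.realize a] := by
    funext i
    fin_cases i <;> rfl
  rw [this]

theorem realize_rel2Formula_std {n : ℕ} (R : U → U → Prop)
    (s t : (fullLanguage U).Term (Fin n)) (a : Fin n → U) :
    (rel2Formula R s t).Realize a ↔ R (s.realize a) (t.realize a) := by
  rw [rel2Formula, Formula.realize_rel]
  exact Iff.rfl

theorem starRel_left (R : U → U → Prop) (f : U → U → U) (c d : U) (a : M.carrier) :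
    M.starRel R (M.emb c) (M.starFun f a (M.emb d)) ↔ a ∈ M.starSet {u | R c (f u d)} := by
  have := M.transfer_forall ((rel2Formula R (nameTerm c) (funTerm f varTerm (nameTerm d))).iff
    (relFormula {u : Fin 1 → U | u 0 ∈ {u | R c (f u d)}}))
    (fun u => by
      rw [Formula.realize_iff, realize_relFormula, realize_rel2Formula_std]
      exact Iff.rfl) ![a]
  rw [Formula.realize_iff, realize_relFormula, realize_rel2Formula, realize_funTerm,
    realize_nameTerm, realize_nameTerm] at this
  exact this

theorem starRel_right (R : U → U → Prop) (f : U → U → U) (c d : U) (a : M.carrier) :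
    M.starRel R (M.starFun f a (M.emb d)) (M.emb c) ↔ a ∈ M.starSet {u | R (f u d) c} := by
  have := M.transfer_forall ((rel2Formula R (funTerm f varTerm (nameTerm d)) (nameTerm c)).iff
    (relFormula {u : Fin 1 → U | u 0 ∈ {u | R (f u d) c}}))
    (fun u => by
      rw [Formula.realize_iff, realize_relFormula, realize_rel2Formula_std]
      exact Iff.rfl) ![a]
  rw [Formula.realize_iff, realize_relFormula, realize_rel2Formula, realize_funTerm,
    realize_nameTerm, realize_nameTerm] at this
  exact this

theorem starRel_emb (R : U → U → Prop) (d : U) (a : M.carrier) :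
    M.starRel R a (M.emb d) ↔ a ∈ M.starSet {u | R u d} := by
  have := M.transfer_forall ((rel2Formula R varTerm (nameTerm d)).iff
    (relFormula {u : Fin 1 → U | u 0 ∈ {u | R u d}}))
    (fun u => by
      rw [Formula.realize_iff, realize_relFormula, realize_rel2Formula_std]
      exact Iff.rfl) ![a]
  rw [Formula.realize_iff, realize_relFormula, realize_rel2Formula, realize_nameTerm] at this
  exact this

end NonstandardExtension

/-! ### The standard objects attached to a space -/

/-- The standard universe attached to `X`: its points, the real numbers, its Borel sets and its
charges. -/
inductive StdUniverse (X : Type*) [MeasurableSpace X]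
  | point (x : X)
  | real (r : ℝ)
  | borel (A : BorelSets X)
  | charge (P : Charge X)

namespace StdUniverse

variable {X : Type*} [MeasurableSpace X]

/-- Membership of a point in a Borel set. -/
def Mem : StdUniverse X → StdUniverse X → Prop
  | point x, borel A => x ∈ A.1
  | _, _ => False

/-- The order of the real numbers. -/
def Lt : StdUniverse X → StdUniverse X → Prop
  | real r, real s => r < s
  | _, _ => False

/-- The evaluation `(P, A) ↦ P A` (and `0` on all other pairs). -/
def eval : StdUniverse X → StdUniverse X → StdUniverse X
  | charge P, borel A => real (P.toFun A)
  | _, _ => real 0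

end StdUniverse

namespace NonstandardExtension

open StdUniverse

variable {X : Type*} [MeasurableSpace X] (M : NonstandardExtension (StdUniverse X))

/-- `*X`. -/
abbrev StarPoint : Type _ := {a : M.carrier // a ∈ M.starSet (range point)}

/-- The internal Borel sets: the elements of `*(Borel sets of X)`. -/
abbrev InternalBorel : Type _ := {b : M.carrier // b ∈ M.starSet (range borel)}

/-- The internal probability measures: the elements of `*(charges on X)`. -/
abbrev InternalProb : Type _ := {ν : M.carrier // ν ∈ M.starSet (range charge)}

/-- `*A ⊆ *X` for a subset `A` of `X`. -/
def starPoints (A : Set X) : Set M.StarPoint := {a | a.1 ∈ M.starSet (point '' A)}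

/-- `*A` as an internal Borel set, for a Borel subset `A` of `X`. -/
def starBorel (A : BorelSets X) : M.InternalBorel :=
  ⟨M.emb (borel A), (M.emb_mem_starSet _ _).2 (mem_range_self A)⟩

/-- The subset of `*X` that an internal Borel set is. -/
def extent (b : M.InternalBorel) : Set M.StarPoint := {a | M.starRel Mem a.1 b.1}

/-- `h ∈ *ℝ` is infinitely close to the real number `r`. -/
def IsStdPart (h : M.carrier) (r : ℝ) : Prop :=
  ∀ ε : ℝ, 0 < ε → M.starRel Lt (M.emb (real (r - ε))) h ∧ M.starRel Lt h (M.emb (real (r + ε)))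

open Classical in
/-- The standard part of a finite hyperreal number (and `0` for anything else). -/
def stdPart (h : M.carrier) : ℝ := if H : ∃ r, M.IsStdPart h r then H.choose else 0

variable {M}

/-- The value `ν(b) ∈ *ℝ`. -/
def value (ν : M.InternalProb) (b : M.InternalBorel) : M.carrier := M.starFun eval ν.1 b.1

theorem extent_starBorel (A : BorelSets X) : M.extent (M.starBorel A) = M.starPoints A.1 := by
  ext a
  have e : {u : StdUniverse X | Mem u (borel A)} = point '' A.1 := by
    ext u
    cases u <;> simp [Mem]
  change M.starRel Mem a.1 (M.emb (borel A)) ↔ a.1 ∈ M.starSet (point '' A.1)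
  rw [starRel_emb, e]

/-- The value of a charge at `A` (and `0` at other objects). -/
def valueAt (A : BorelSets X) : StdUniverse X → ℝ
  | charge P => P.toFun A
  | _ => 0

theorem isStdPart_value_iff (ν : M.InternalProb) (A : BorelSets X) (r : ℝ) :
    M.IsStdPart (value ν (M.starBorel A)) r ↔
      Tendsto (valueAt A) (M.starUltrafilter ν.1) (𝓝 r) := by
  have e : ∀ u : StdUniverse X, eval u (borel A) = real (valueAt A u) := by
    intro u
    cases u <;> rfl
  have h1 : ∀ q : ℝ, M.starRel Lt (M.emb (real q)) (value ν (M.starBorel A)) ↔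
      ∀ᶠ u in (M.starUltrafilter ν.1 : Filter (StdUniverse X)), q < valueAt A u := by
    intro q
    refine (M.starRel_left Lt eval (real q) (borel A) ν.1).trans ?_
    simp only [e]
    exact Iff.rfl
  have h2 : ∀ q : ℝ, M.starRel Lt (value ν (M.starBorel A)) (M.emb (real q)) ↔
      ∀ᶠ u in (M.starUltrafilter ν.1 : Filter (StdUniverse X)), valueAt A u < q := by
    intro q
    refine (M.starRel_right Lt eval (real q) (borel A) ν.1).trans ?_
    simp only [e]
    exact Iff.rfl
  simp only [IsStdPart, h1, h2, ← Filter.eventually_and]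
  rw [Metric.tendsto_nhds]
  refine forall_congr' fun ε => forall_congr' fun _ => ?_
  refine eventually_congr (Eventually.of_forall fun u => ?_)
  rw [Real.dist_eq, abs_lt]
  constructor <;> rintro ⟨h, h'⟩ <;> constructor <;> linarith

theorem eventually_charge (ν : M.InternalProb) :
    ∀ᶠ u in (M.starUltrafilter ν.1 : Filter (StdUniverse X)), u ∈ range charge := ν.2

theorem charge_le_one (P : Charge X) (A : BorelSets X) : P.toFun A ≤ 1 := by
  have h := P.map_union A ⟨A.1ᶜ, A.2.compl⟩ disjoint_compl_right
  simp only [union_compl_self] at h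
  rw [P.map_univ] at h
  linarith [P.nonneg ⟨A.1ᶜ, A.2.compl⟩]

theorem tendsto_stdPart (ν : M.InternalProb) (A : BorelSets X) :
    Tendsto (valueAt A) (M.starUltrafilter ν.1) (𝓝 (M.stdPart (value ν (M.starBorel A)))) := by
  have H : ∃ r, M.IsStdPart (value ν (M.starBorel A)) r := by
    have hI : ∀ᶠ u in (M.starUltrafilter ν.1 : Filter (StdUniverse X)),
        valueAt A u ∈ Icc (0 : ℝ) 1 := by
      filter_upwards [eventually_charge ν]
      rintro _ ⟨P, rfl⟩
      exact ⟨P.nonneg A, charge_le_one P A⟩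
    obtain ⟨r, -, hr⟩ := isCompact_Icc.ultrafilter_le_nhds
      ((M.starUltrafilter ν.1).map (valueAt A)) (le_principal_iff.2 hI)
    exact ⟨r, (isStdPart_value_iff ν A r).2 hr⟩
  rw [← isStdPart_value_iff, stdPart, dif_pos H]
  exact H.choose_spec

theorem stdPart_unique (ν : M.InternalProb) (A : BorelSets X) {g : StdUniverse X → ℝ} {r : ℝ}
    (hg : Tendsto g (M.starUltrafilter ν.1) (𝓝 r))
    (h : ∀ P, valueAt A (charge P) = g (charge P)) :
    M.stdPart (value ν (M.starBorel A)) = r := by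
  refine tendsto_nhds_unique ((tendsto_stdPart ν A).congr' ?_) hg
  filter_upwards [eventually_charge ν]
  rintro _ ⟨P, rfl⟩
  exact h P

/-! ### The two push-downs -/

/-- The internal push-down `A ↦ st (ν (*A))` of an internal probability measure. -/
def internalPushDown (ν : M.InternalProb) : Charge X where
  toFun A := M.stdPart (value ν (M.starBorel A))
  nonneg A := by
    refine ge_of_tendsto (tendsto_stdPart ν A) ?_
    filter_upwards [eventually_charge ν]
    rintro _ ⟨P, rfl⟩
    exact P.nonneg A
  map_empty := stdPart_unique ν _ (tendsto_const_nhds (x := (0 : ℝ))) fun P => P.map_empty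
  map_univ := stdPart_unique ν _ (tendsto_const_nhds (x := (1 : ℝ))) fun P => P.map_univ
  map_union A B hAB := stdPart_unique ν _ ((tendsto_stdPart ν A).add (tendsto_stdPart ν B))
    fun P => P.map_union A B hAB

/-- The set function `st ∘ ν` on the internal Borel sets, with the value `∞` at all other subsets
of `*X`. (An internal Borel set is determined by its elements.) -/
def loebPremeasure (ν : M.InternalProb) (s : Set M.StarPoint) : ℝ≥0∞ :=
  ⨅ (b : M.InternalBorel) (_ : M.extent b = s), ENNReal.ofReal (M.stdPart (value ν b))

theorem loebPremeasure_empty (ν : M.InternalProb) : loebPremeasure ν ∅ = 0 := by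
  have h : M.extent (M.starBorel (X := X) ⟨∅, MeasurableSet.empty⟩) = ∅ := by
    rw [extent_starBorel]
    ext a
    have h0 := (M.mem_starSet_compl univ a.1).1.mt (not_not.2 (M.mem_starSet_univ a.1))
    simpa [starPoints] using h0
  refine le_antisymm (iInf₂_le_of_le _ h ?_) bot_le
  rw [show M.stdPart (value ν (M.starBorel ⟨∅, MeasurableSet.empty⟩)) = 0 from
    (internalPushDown ν).map_empty, ENNReal.ofReal_zero]

/-- The outer measure on `*X` generated by `st ∘ ν`. -/
def loebOuterMeasure (ν : M.InternalProb) : OuterMeasure M.StarPoint :=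
  OuterMeasure.ofFunction (loebPremeasure ν) (loebPremeasure_empty ν)

/-- The Loeb σ-algebra: the sets that are measurable in the sense of Carathéodory, equivalently
the completion of the σ-algebra generated by the internal Borel sets. -/
abbrev loebSigmaAlgebra (ν : M.InternalProb) : MeasurableSpace M.StarPoint :=
  (loebOuterMeasure ν).caratheodory

/-- The Loeb measure of an internal probability measure. -/
def loebMeasure (ν : M.InternalProb) : @Measure M.StarPoint (loebSigmaAlgebra ν) :=
  @OuterMeasure.toMeasure M.StarPoint (loebSigmaAlgebra ν) (loebOuterMeasure ν) le_rfl

variable (M) in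
/-- The monad of a point: the intersection of the stars of its open neighbourhoods. -/
def monad [TopologicalSpace X] (x : X) : Set M.StarPoint :=
  ⋂ (V : Set X) (_ : IsOpen V) (_ : x ∈ V), M.starPoints V

variable (M) in
/-- `st⁻¹(C)`: the points of `*X` that are infinitely close to a point of `C`. -/
def stPreimage [TopologicalSpace X] (C : Set X) : Set M.StarPoint := ⋃ x ∈ C, M.monad x

/-- The external push-down `C ↦ Loeb(ν)(st⁻¹(C))` is defined on all Borel sets `C` and is equal
there to the measure `P`. -/
def IsExternalPushDown [TopologicalSpace X] (ν : M.InternalProb) (P : Measure X) : Prop :=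
  ∀ C : Set X, MeasurableSet C →
    MeasurableSet[loebSigmaAlgebra ν] (M.stPreimage C) ∧
      loebMeasure ν (M.stPreimage C) = P C

end NonstandardExtension

end

/-! Everything rests on a one-sided comparison on open sets. A point of `*X` that is infinitely
close to a point of an open set `V` lies in `*V`, so `st⁻¹(V) ⊆ *V` and the external push-down is at
most the internal one on open sets (`le_internalPushDown_of_isOpen`).

Such an inequality already forces equal integrals of bounded continuous functions
(`Charge.integral_eq_of_le_on_open`). The superlevel sets of `f` are open, so a finite layer-cake
sum gives one inequality between the integrals of `f`; those of `-f` are open too, which gives the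
reverse one. On a bounded space 1-Lipschitz functions are bounded and continuous, so the Wasserstein
distance vanishes.

For the failure of separation, take `x` non-isolated. Saturation yields a point `y` in the monad of
`x` with `y ∈ *({x}ᶜ)`. The Loeb measure of the internal Dirac measure at `y` is two-valued; its
external push-down is the Dirac measure at `x`, while the internal push-down gives `{x}ᶜ` mass 1.
The standard analogue replaces `y` by an ultrafilter converging to `x` through other points. -/

noncomputable section

/-! ### Integration of simple functions against a charge -/

namespace Charge

open SimpleFunc

variable {X : Type*} [MeasurableSpace X]

/-- A charge as a function with values in the continuous linear maps, extended by zero to the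
sets that are not measurable. -/
def toSetFunction (P : Charge X) (A : Set X) : ℝ →L[ℝ] ℝ :=
  open Classical in
  (if h : MeasurableSet A then P.toFun ⟨A, h⟩ else 0) • ContinuousLinearMap.id ℝ ℝ

theorem toSetFunction_apply (P : Charge X) {A : Set X} (h : MeasurableSet A) (c : ℝ) :
    P.toSetFunction A c = P.toFun ⟨A, h⟩ * c := by
  simp [toSetFunction, h]

/-- Over the zero measure the finiteness and integrability side conditions are automatic, so the
linearity and monotonicity of `setToSimpleFunc` become available for a merely finitely additive set
function. -/
theorem finMeasAdditive_toSetFunction (P : Charge X) :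
    FinMeasAdditive (0 : Measure X) P.toSetFunction := by
  intro s t hs ht _ _ hst
  ext
  simp [toSetFunction_apply, hs, ht, hs.union ht, P.map_union ⟨s, hs⟩ ⟨t, ht⟩ hst]

theorem toSetFunction_nonneg (P : Charge X) (A : Set X) (c : ℝ) (hc : 0 ≤ c) :
    0 ≤ P.toSetFunction A c := by
  by_cases h : MeasurableSet A
  · rw [toSetFunction_apply P h]
    exact mul_nonneg (P.nonneg _) hc
  · simp [toSetFunction, h]

theorem simpleIntegral_eq_setToSimpleFunc (P : Charge X) (s : SimpleFunc X ℝ) :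
    P.simpleIntegral s = s.setToSimpleFunc P.toSetFunction :=
  Finset.sum_congr rfl fun y _ => by
    rw [toSetFunction_apply P (s.measurableSet_fiber y), mul_comm]

theorem simpleIntegral_add (P : Charge X) (s t : SimpleFunc X ℝ) :
    P.simpleIntegral (s + t) = P.simpleIntegral s + P.simpleIntegral t := by
  simp only [simpleIntegral_eq_setToSimpleFunc]
  exact setToSimpleFunc_add _ P.finMeasAdditive_toSetFunction integrable_zero_measure
    integrable_zero_measure

theorem simpleIntegral_neg (P : Charge X) (s : SimpleFunc X ℝ) :
    P.simpleIntegral (-s) = -P.simpleIntegral s := by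
  simp only [simpleIntegral_eq_setToSimpleFunc]
  exact setToSimpleFunc_neg _ P.finMeasAdditive_toSetFunction integrable_zero_measure

theorem simpleIntegral_mono (P : Charge X) {s t : SimpleFunc X ℝ} (h : ∀ x, s x ≤ t x) :
    P.simpleIntegral s ≤ P.simpleIntegral t := by
  simp only [simpleIntegral_eq_setToSimpleFunc]
  exact setToSimpleFunc_mono P.finMeasAdditive_toSetFunction
    (fun A _ _ c hc => P.toSetFunction_nonneg A c hc) integrable_zero_measure
    integrable_zero_measure h

theorem toSetFunction_empty (P : Charge X) : P.toSetFunction ∅ = 0 := by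
  ext
  rw [toSetFunction_apply P MeasurableSet.empty, P.map_empty]
  simp

theorem simpleIntegral_const (P : Charge X) (c : ℝ) :
    P.simpleIntegral (SimpleFunc.const X c) = c := by
  rw [simpleIntegral_eq_setToSimpleFunc, setToSimpleFunc_const _ P.toSetFunction_empty,
    toSetFunction_apply P MeasurableSet.univ, P.map_univ, one_mul]

theorem simpleIntegral_indicator (P : Charge X) {A : Set X} (hA : MeasurableSet A) (c : ℝ) :
    P.simpleIntegral (piecewise A hA (SimpleFunc.const X c) (SimpleFunc.const X 0)) =
      P.toFun ⟨A, hA⟩ * c := by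
  rw [simpleIntegral_eq_setToSimpleFunc, setToSimpleFunc_indicator _ P.toSetFunction_empty,
    toSetFunction_apply P hA]

/-- The simple functions below a bounded function have bounded integrals. -/
theorem bddAbove_simpleIntegral (P : Charge X) {f : X → ℝ} {b : ℝ} (hb : ∀ x, f x ≤ b) :
    BddAbove {I : ℝ | ∃ s : SimpleFunc X ℝ, (∀ x, s x ≤ f x) ∧ I = P.simpleIntegral s} := by
  refine ⟨b, ?_⟩
  rintro _ ⟨s, hs, rfl⟩
  calc P.simpleIntegral s ≤ P.simpleIntegral (SimpleFunc.const X b) :=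
        P.simpleIntegral_mono fun x => (hs x).trans (hb x)
    _ = b := P.simpleIntegral_const b

theorem simpleIntegral_le_integral (P : Charge X) {f : X → ℝ} {b : ℝ} (hb : ∀ x, f x ≤ b)
    {s : SimpleFunc X ℝ} (hs : ∀ x, s x ≤ f x) : P.simpleIntegral s ≤ P.integral f :=
  le_csSup (P.bddAbove_simpleIntegral hb) ⟨s, hs, rfl⟩

theorem integral_le_simpleIntegral (P : Charge X) {f : X → ℝ} {a : ℝ} (ha : ∀ x, a ≤ f x)
    {s : SimpleFunc X ℝ} (hs : ∀ x, f x ≤ s x) : P.integral f ≤ P.simpleIntegral s := by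
  refine csSup_le ⟨_, SimpleFunc.const X a, ha, rfl⟩ ?_
  rintro _ ⟨t, ht, rfl⟩
  exact P.simpleIntegral_mono fun x => (ht x).trans (hs x)

theorem integral_mem_Icc (P : Charge X) {f : X → ℝ} {a b : ℝ} (ha : ∀ x, a ≤ f x)
    (hb : ∀ x, f x ≤ b) : P.integral f ∈ Icc a b :=
  ⟨(P.simpleIntegral_const a).ge.trans (P.simpleIntegral_le_integral hb ha),
    (P.integral_le_simpleIntegral ha hb).trans (P.simpleIntegral_const b).le⟩

/-! ### Layer-cake approximation and comparison of integrals -/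

/-- The step function `∑ ε 1_{f > a + (k + 1) ε}` over `k < n`. -/
def levelStep {f : X → ℝ} (hf : Measurable f) (a ε : ℝ) (n : ℕ) : SimpleFunc X ℝ :=
  ∑ k ∈ Finset.range n, piecewise {x | a + (k + 1) * ε < f x}
    (measurableSet_lt measurable_const hf) (SimpleFunc.const X ε) (SimpleFunc.const X 0)

theorem levelStep_succ {f : X → ℝ} (hf : Measurable f) (a ε : ℝ) (n : ℕ) :
    levelStep hf a ε (n + 1) = levelStep hf a ε n + piecewise {x | a + (n + 1) * ε < f x}
      (measurableSet_lt measurable_const hf) (SimpleFunc.const X ε) (SimpleFunc.const X 0) :=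
  Finset.sum_range_succ _ _

theorem levelStep_zero {f : X → ℝ} (hf : Measurable f) (a ε : ℝ) :
    levelStep hf a ε 0 = SimpleFunc.const X 0 := by
  rfl

/-- The disjunction is the induction invariant: either the steps have come within `ε` of `f x`, or
every level so far has been passed and the sum is full. -/
theorem levelStep_bounds {f : X → ℝ} (hf : Measurable f) {a ε : ℝ} (hε : 0 < ε)
    (ha : ∀ x, a ≤ f x) (n : ℕ) (x : X) :
    a + levelStep hf a ε n x ≤ f x ∧
      (f x ≤ a + levelStep hf a ε n x + ε ∨ levelStep hf a ε n x = n * ε) := by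
  induction n with
  | zero => simpa [levelStep_zero] using ha x
  | succ n ih =>
    have h : levelStep hf a ε (n + 1) x =
        levelStep hf a ε n x + if a + (n + 1) * ε < f x then ε else 0 := by
      rw [levelStep_succ, SimpleFunc.add_apply, piecewise_apply]
      rfl
    -- Each summand is at most `ε`. Hence adding one more step at a point where `f` exceeds level `n
    -- + 1` keeps the sum below `f`.
    have hle : levelStep hf a ε n x ≤ n * ε := by
      clear ih h
      induction n with
      | zero => simp [levelStep_zero]
      | succ n ih =>
        rw [levelStep_succ, SimpleFunc.add_apply, piecewise_apply]
        push_cast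
        split_ifs <;> simp only [SimpleFunc.coe_const, Function.const_apply] <;> linarith
    rw [h]
    push_cast
    split_ifs with hx
    · refine ⟨by linarith, ?_⟩
      -- The first alternative is contradictory: it would give `f x ≤ a + (n + 1) * ε`.
      rcases ih.2 with h' | h'
      · right
        linarith
      · right
        linarith
    · refine ⟨by linarith [ih.1], Or.inl ?_⟩
      rcases ih.2 with h' | h' <;> linarith

/-- The integral of a level step is `ε` times a sum of masses of superlevel sets of `f`, so only
these sets have to be compared. -/
theorem simpleIntegral_levelStep_le {P Q : Charge X} {f : X → ℝ} (hf : Measurable f) {a ε : ℝ}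
    (hε : 0 ≤ ε) (h : ∀ c : ℝ, P.toFun ⟨{x | c < f x}, measurableSet_lt measurable_const hf⟩ ≤
      Q.toFun ⟨{x | c < f x}, measurableSet_lt measurable_const hf⟩) (n : ℕ) :
    P.simpleIntegral (levelStep hf a ε n) ≤ Q.simpleIntegral (levelStep hf a ε n) := by
  induction n with
  | zero => rw [levelStep_zero, simpleIntegral_const, simpleIntegral_const]
  | succ n ih =>
    rw [levelStep_succ, simpleIntegral_add, simpleIntegral_add, simpleIntegral_indicator,
      simpleIntegral_indicator]
    exact add_le_add ih (mul_le_mul_of_nonneg_right (h _) hε)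

/-- A bounded measurable function is uniformly approximated by its level steps. -/
theorem exists_levelStep_approx {f : X → ℝ} (hf : Measurable f) {a b ε : ℝ} (hε : 0 < ε)
    (ha : ∀ x, a ≤ f x) (hb : ∀ x, f x ≤ b) :
    ∃ n : ℕ, ∀ x, a + levelStep hf a ε n x ≤ f x ∧ f x ≤ a + levelStep hf a ε n x + ε := by
  -- With `n * ε ≥ b - a`, a full sum already reaches the upper bound `b`.
  obtain ⟨n, hn⟩ := exists_nat_ge ((b - a) / ε)
  rw [div_le_iff₀ hε] at hn
  refine ⟨n, fun x => ⟨(levelStep_bounds hf hε ha n x).1, ?_⟩⟩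
  rcases (levelStep_bounds hf hε ha n x).2 with h | h
  · exact h
  · linarith [hb x]

theorem integral_approx (P : Charge X) {f : X → ℝ} {a b ε : ℝ} (ha : ∀ x, a ≤ f x)
    (hb : ∀ x, f x ≤ b) {s : SimpleFunc X ℝ} {c : ℝ}
    (hs : ∀ x, c + s x ≤ f x ∧ f x ≤ c + s x + ε) :
    c + P.simpleIntegral s ≤ P.integral f ∧ P.integral f ≤ c + P.simpleIntegral s + ε := by
  have h1 := P.simpleIntegral_le_integral hb (s := SimpleFunc.const X c + s) fun x => (hs x).1
  have h2 := P.integral_le_simpleIntegral ha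
    (s := SimpleFunc.const X c + s + SimpleFunc.const X ε) fun x => (hs x).2
  simp only [simpleIntegral_add, simpleIntegral_const] at h1 h2
  exact ⟨h1, h2⟩

/-- The integral is defined from below only, and negation turns lower approximations into upper
ones; uniform approximation makes the two agree. -/
theorem integral_neg (P : Charge X) {f : X → ℝ} (hf : Measurable f) {a b : ℝ}
    (ha : ∀ x, a ≤ f x) (hb : ∀ x, f x ≤ b) : P.integral (fun x => -f x) = -P.integral f := by
  refine eq_of_forall_dist_le fun ε hε => ?_
  obtain ⟨n, hn⟩ := exists_levelStep_approx hf hε ha hb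
  have h1 := P.integral_approx ha hb hn
  -- The extra `-ε` moves the negated step function, which lies above `-f`, to below it.
  have h2 := P.integral_approx (f := fun x => -f x) (s := -levelStep hf a ε n) (c := -a - ε)
    (ε := ε) (fun x => neg_le_neg (hb x)) (fun x => neg_le_neg (ha x)) fun x => by
      simp only [SimpleFunc.coe_neg, Pi.neg_apply]
      constructor <;> linarith [hn x]
  rw [simpleIntegral_neg] at h2
  rw [Real.dist_eq, abs_le]
  constructor <;> linarith [h1.1, h1.2, h2.1, h2.2]

/-- Charges whose values on the strict superlevel sets of `f` are ordered have ordered integrals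
of `f`. -/
theorem integral_le_of_superlevel_le {P Q : Charge X} {f : X → ℝ} (hf : Measurable f) {a b : ℝ}
    (ha : ∀ x, a ≤ f x) (hb : ∀ x, f x ≤ b)
    (h : ∀ c : ℝ, P.toFun ⟨{x | c < f x}, measurableSet_lt measurable_const hf⟩ ≤
      Q.toFun ⟨{x | c < f x}, measurableSet_lt measurable_const hf⟩) :
    P.integral f ≤ Q.integral f := by
  refine le_of_forall_pos_le_add fun ε hε => ?_
  obtain ⟨n, hn⟩ := exists_levelStep_approx hf hε ha hb
  linarith [(P.integral_approx ha hb hn).2, (Q.integral_approx ha hb hn).1,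
    simpleIntegral_levelStep_le (a := a) hf hε.le h n]

/-- If a charge is below another one on the open sets, then they agree on the bounded continuous
functions. -/
theorem integral_eq_of_le_on_open [TopologicalSpace X] [OpensMeasurableSpace X] {P Q : Charge X}
    (h : ∀ A : BorelSets X, IsOpen A.1 → P.toFun A ≤ Q.toFun A) {f : X → ℝ} (hf : Continuous f)
    {a b : ℝ} (ha : ∀ x, a ≤ f x) (hb : ∀ x, f x ≤ b) : P.integral f = Q.integral f := by
  refine le_antisymm (integral_le_of_superlevel_le hf.measurable ha hb fun c =>
    h _ (isOpen_lt continuous_const hf)) ?_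
  -- Continuity enters a second time: the sets `{c < -f}` are open as well.
  have hle := integral_le_of_superlevel_le (P := P) (Q := Q) hf.neg.measurable
    (fun x => neg_le_neg (hb x)) (fun x => neg_le_neg (ha x)) fun c =>
    h _ (isOpen_lt continuous_const hf.neg)
  change P.integral (fun x => -f x) ≤ Q.integral (fun x => -f x) at hle
  rw [integral_neg P hf.measurable ha hb, integral_neg Q hf.measurable ha hb] at hle
  linarith

theorem nonempty (P : Charge X) : Nonempty X := by
  by_contra h
  rw [not_nonempty_iff] at h
  have h1 : P.toFun ⟨∅, MeasurableSet.empty⟩ = P.toFun ⟨univ, MeasurableSet.univ⟩ :=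
    congrArg P.toFun (Subtype.ext (Subsingleton.elim _ _))
  rw [P.map_empty, P.map_univ] at h1
  exact zero_ne_one h1

/-! ### Two-valued charges -/

open Classical in
/-- The two-valued charge of an ultrafilter. -/
def ofUltrafilter (F : Ultrafilter X) : Charge X where
  toFun A := if A.1 ∈ F then 1 else 0
  nonneg A := by split_ifs <;> norm_num
  map_empty := by simp
  map_univ := if_pos Filter.univ_mem
  map_union A B h := by
    have hAB : A.1 ∈ F → B.1 ∉ F := fun hA hB => by
      have := Filter.inter_mem hA hB
      rw [h.inter_eq] at this
      exact F.empty_notMem this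
    by_cases hA : A.1 ∈ F
    · simp [Ultrafilter.union_mem_iff, hA, hAB hA]
    · simp [Ultrafilter.union_mem_iff, hA]

theorem ofUltrafilter_of_mem {F : Ultrafilter X} {A : BorelSets X} (h : A.1 ∈ F) :
    (ofUltrafilter F).toFun A = 1 := if_pos h

theorem ofUltrafilter_of_notMem {F : Ultrafilter X} {A : BorelSets X} (h : A.1 ∉ F) :
    (ofUltrafilter F).toFun A = 0 := if_neg h

end Charge

/-! ### The Wasserstein pseudometric -/

theorem LipschitzWith.exists_bounds {X : Type*} [PseudoMetricSpace X] [BoundedSpace X]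
    [Nonempty X] {f : X → ℝ}
    (hf : LipschitzWith 1 f) :
    ∃ a : ℝ, (∀ x, a ≤ f x) ∧ ∀ x, f x ≤ a + 2 * Metric.diam (univ : Set X) := by
  obtain ⟨x₀⟩ := ‹Nonempty X›
  have h : ∀ x, |f x - f x₀| ≤ Metric.diam (univ : Set X) := fun x => by
    have h1 := hf.dist_le_mul x x₀
    rw [NNReal.coe_one, one_mul, Real.dist_eq] at h1
    exact h1.trans (Metric.dist_le_diam_of_mem BoundedSpace.bounded_univ (mem_univ _) (mem_univ _))
  refine ⟨f x₀ - Metric.diam (univ : Set X), fun x => ?_, fun x => ?_⟩ <;>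
    linarith [(abs_le.1 (h x)).1, (abs_le.1 (h x)).2]

section Wasserstein

variable {X : Type*} [MetricSpace X] [MeasurableSpace X]

theorem wasserstein_eq_zero_of_le_on_open [BorelSpace X] [BoundedSpace X] {P Q : Charge X}
    (h : ∀ A : BorelSets X, IsOpen A.1 → P.toFun A ≤ Q.toFun A) : wasserstein P Q = 0 := by
  have := P.nonempty
  refine le_antisymm (iSup₂_le fun f hf => ?_) bot_le
  obtain ⟨a, ha, hb⟩ := hf.exists_bounds
  rw [Charge.integral_eq_of_le_on_open h hf.continuous ha hb]
  simp

theorem wasserstein_ne_top [BoundedSpace X] (P Q : Charge X) : wasserstein P Q ≠ ∞ := by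
  have := P.nonempty
  refine ne_top_of_le_ne_top
    (ENNReal.ofReal_ne_top (r := 2 * Metric.diam (univ : Set X))) (iSup₂_le fun f hf => ?_)
  obtain ⟨a, ha, hb⟩ := hf.exists_bounds
  have hP := P.integral_mem_Icc ha hb
  have hQ := Q.integral_mem_Icc ha hb
  refine ENNReal.ofReal_le_ofReal (abs_le.2 ⟨?_, ?_⟩) <;>
    linarith [hP.1, hP.2, hQ.1, hQ.2]

theorem wasserstein_self (P : Charge X) : wasserstein P P = 0 := by
  simp [wasserstein]

theorem wasserstein_comm (P Q : Charge X) : wasserstein P Q = wasserstein Q P := by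
  simp only [wasserstein, abs_sub_comm]

theorem wasserstein_triangle (P Q R : Charge X) :
    wasserstein P R ≤ wasserstein P Q + wasserstein Q R := by
  refine iSup₂_le fun f hf => ?_
  calc ENNReal.ofReal |P.integral f - R.integral f|
      ≤ ENNReal.ofReal (|P.integral f - Q.integral f| + |Q.integral f - R.integral f|) :=
        ENNReal.ofReal_le_ofReal (abs_sub_le _ _ _)
    _ = ENNReal.ofReal |P.integral f - Q.integral f| +
          ENNReal.ofReal |Q.integral f - R.integral f| :=
        ENNReal.ofReal_add (abs_nonneg _) (abs_nonneg _)
    _ ≤ _ := add_le_add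
        (le_iSup₂ (f := fun (f : X → ℝ) (_ : LipschitzWith 1 f) =>
          ENNReal.ofReal |P.integral f - Q.integral f|) f hf)
        (le_iSup₂ (f := fun (f : X → ℝ) (_ : LipschitzWith 1 f) =>
          ENNReal.ofReal |Q.integral f - R.integral f|) f hf)

/-- The Dirac charge at `x` and the charge of an ultrafilter that converges to `x` through other
points. -/
theorem exists_ne_wasserstein_eq_zero [BorelSpace X] [BoundedSpace X] (x : X) [(𝓝[≠] x).NeBot] :
    ∃ P Q : Charge X, P ≠ Q ∧ wasserstein P Q = 0 := by
  have hF : (Ultrafilter.of (𝓝[≠] x) : Filter X) ≤ 𝓝[≠] x := Ultrafilter.of_le _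
  refine ⟨Charge.ofUltrafilter (pure x), Charge.ofUltrafilter (Ultrafilter.of (𝓝[≠] x)),
    fun h => ?_, wasserstein_eq_zero_of_le_on_open fun A hA => ?_⟩
  · have h1 := congrFun (congrArg Charge.toFun h) ⟨{x}ᶜ, (measurableSet_singleton x).compl⟩
    rw [Charge.ofUltrafilter_of_notMem (by simp),
      Charge.ofUltrafilter_of_mem (hF self_mem_nhdsWithin)] at h1
    exact zero_ne_one h1
  -- An open set containing `x` belongs to both ultrafilters. One that misses `x` has Dirac mass 0,
  -- so its mass under the other charge is irrelevant.
  · by_cases hx : x ∈ A.1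
    · rw [Charge.ofUltrafilter_of_mem (F := pure x) (by simpa using hx),
        Charge.ofUltrafilter_of_mem (hF (mem_nhdsWithin_of_mem_nhds (hA.mem_nhds hx)))]
    · rw [Charge.ofUltrafilter_of_notMem (F := pure x) (by simpa using hx)]
      exact Charge.nonneg _ _

end Wasserstein

namespace NonstandardExtension

open FirstOrder FirstOrder.Language StdUniverse

/-! ### Further instances of transfer and saturation -/

section Transfer

variable {U : Type*} (M : NonstandardExtension U)

/-- The formula `t ∈ A`. -/
def memFormula {n : ℕ} (A : Set U) (t : (fullLanguage U).Term (Fin n)) :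
    (fullLanguage U).Formula (Fin n) :=
  Relations.formula (relationSymbol {u : Fin 1 → U | u 0 ∈ A}) ![t]

theorem realize_memFormula {n : ℕ} (A : Set U) (t : (fullLanguage U).Term (Fin n))
    (a : Fin n → M.carrier) : (memFormula A t).Realize a ↔ t.realize a ∈ M.starSet A := by
  rw [memFormula, Formula.realize_rel, starSet, mem_ofPred_eq, starRelation]
  have : (fun i => Term.realize a (![t] i)) = ![t.realize a] := by
    funext i
    fin_cases i
    rfl
  rw [this]

theorem realize_memFormula_std {n : ℕ} (A : Set U) (t : (fullLanguage U).Term (Fin n))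
    (a : Fin n → U) : (memFormula A t).Realize a ↔ t.realize a ∈ A := by
  rw [memFormula, Formula.realize_rel]
  exact Iff.rfl

/-- Since `starFun` takes binary functions, a unary map is coded here and below as a binary one
evaluated on the diagonal. -/
theorem starFun_self_mem_starSet (A : Set U) (g : U → U → U) (a : M.carrier) :
    M.starFun g a a ∈ M.starSet A ↔ a ∈ M.starSet {u | g u u ∈ A} := by
  have := M.transfer_forall ((memFormula A (funTerm g varTerm varTerm)).iff
    (memFormula {u | g u u ∈ A} varTerm))
    (fun u => by
      rw [Formula.realize_iff, realize_memFormula_std, realize_memFormula_std]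
      exact Iff.rfl) ![a]
  rw [Formula.realize_iff, realize_memFormula, realize_memFormula, realize_funTerm] at this
  exact this

theorem starFun_eq_of_starRel {R : U → U → Prop} {f g : U → U → U} {d : U}
    (h : ∀ u v, R u v → f (g u u) v = d) {a b : M.carrier} (hab : M.starRel R a b) :
    M.starFun f (M.starFun g a a) b = M.emb d := by
  have := M.transfer_forall ((rel2Formula R (Term.var 0) (Term.var 1)).imp
    (Term.equal (funTerm f (funTerm g (Term.var (0 : Fin 2)) (Term.var 0)) (Term.var 1))
      (nameTerm d)))
    (fun u => by
      rw [Formula.realize_imp, Formula.realize_equal, realize_rel2Formula_std]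
      exact h (u 0) (u 1)) ![a, b]
  rw [Formula.realize_imp, Formula.realize_equal, realize_rel2Formula, realize_funTerm,
    realize_funTerm, realize_nameTerm] at this
  exact this hab

theorem starFun_comp_eq {f g k : U → U → U} {d : U} (h : ∀ u, f (g u u) (k u u) = d)
    (a : M.carrier) : M.starFun f (M.starFun g a a) (M.starFun k a a) = M.emb d := by
  have := M.transfer_forall
    (Term.equal (funTerm f (funTerm g varTerm varTerm) (funTerm k varTerm varTerm)) (nameTerm d))
    (fun u => by
      rw [Formula.realize_equal]
      exact h (u 0)) ![a]
  rw [Formula.realize_equal, realize_funTerm, realize_funTerm, realize_funTerm,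
    realize_nameTerm] at this
  exact this

/-- Meant for `R` membership and `k` the complement of a singleton: distinct points of `*X` lie in
each other's internal complements. -/
theorem starRel_of_ne {R : U → U → Prop} {k : U → U → U} {S : Set U}
    (h : ∀ u ∈ S, ∀ v ∈ S, u ≠ v → R v (k u u)) {a b : M.carrier} (ha : a ∈ M.starSet S)
    (hb : b ∈ M.starSet S) (hab : a ≠ b) : M.starRel R b (M.starFun k a a) := by
  have := M.transfer_forall ((memFormula S (Term.var 0)).imp ((memFormula S (Term.var 1)).imp
    ((Term.equal (Term.var (0 : Fin 2)) (Term.var 1)).not.imp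
      (rel2Formula R (Term.var 1) (funTerm k (Term.var 0) (Term.var 0))))))
    (fun u => by
      simp only [Formula.realize_imp, Formula.realize_not, Formula.realize_equal,
        realize_rel2Formula_std, realize_memFormula_std]
      exact fun h0 h1 => h (u 0) h0 (u 1) h1) ![a, b]
  simp only [Formula.realize_imp, Formula.realize_not, Formula.realize_equal,
    realize_rel2Formula, realize_memFormula, realize_funTerm] at this
  exact this ha hb hab

/-- Countable saturation for the stars of subsets of `U`. -/
theorem exists_mem_starSet [Nonempty U] (A : ℕ → Set U)
    (hA : ∀ n, (⋂ k ∈ Finset.range n, A k).Nonempty) : ∃ a, ∀ n, a ∈ M.starSet (A n) := by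
  obtain ⟨d⟩ := ‹Nonempty U›
  obtain ⟨a, ha⟩ := M.saturated (fun n => M.starSet (A n))
    -- Internal sets are sections of binary relations, so a dummy parameter `d` is supplied.
    (fun n => ⟨{u | u 0 ∈ A n}, M.emb d, by
      ext a
      exact (M.starRel_emb (fun u _ => u ∈ A n) d a).symm⟩)
    (fun n => by
      obtain ⟨u, hu⟩ := hA n
      refine ⟨M.emb u, ?_⟩
      simp only [mem_iInter] at hu ⊢
      exact fun k hk => (M.emb_mem_starSet _ _).2 (hu k hk))
  exact ⟨a, mem_iInter.1 ha⟩

end Transfer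

/-! ### Comparison of the two push-downs on open sets -/

section PushDown

variable {X : Type*} [MeasurableSpace X] {M : NonstandardExtension (StdUniverse X)}

/-- `stdPart` is a choice, so uniqueness has to be shown: every candidate is within each `ε` of `r`.
-/
theorem stdPart_emb_real (r : ℝ) : M.stdPart (M.emb (real r)) = r := by
  have h : ∀ q s : ℝ, M.starRel Lt (M.emb (real q)) (M.emb (real s)) ↔ q < s := fun q s => by
    rw [starRel_emb, emb_mem_starSet]
    exact Iff.rfl
  have H : ∃ q, M.IsStdPart (M.emb (real r)) q := ⟨r, fun ε hε => by
    rw [h, h]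
    constructor <;> linarith⟩
  rw [stdPart, dif_pos H]
  refine eq_of_forall_dist_le fun ε hε => ?_
  have := H.choose_spec ε hε
  rw [h, h] at this
  rw [Real.dist_eq, abs_le]
  constructor <;> linarith

theorem starPoints_univ : M.starPoints (univ : Set X) = univ :=
  eq_univ_of_forall fun a => by
    rw [starPoints, image_univ]
    exact a.2

theorem stPreimage_subset_starPoints [TopologicalSpace X] {V : Set X} (hV : IsOpen V) :
    M.stPreimage V ⊆ M.starPoints V :=
  iUnion₂_subset fun _ hx => iInter_subset_of_subset V (iInter₂_subset hV hx)

theorem loebOuterMeasure_extent_le (ν : M.InternalProb) (b : M.InternalBorel) :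
    loebOuterMeasure ν (M.extent b) ≤ ENNReal.ofReal (M.stdPart (value ν b)) :=
  (OuterMeasure.ofFunction_le _).trans (iInf₂_le (f := fun (c : M.InternalBorel) (_ : M.extent c = M.extent b) =>
    ENNReal.ofReal (M.stdPart (value ν c))) b rfl)

theorem loebMeasure_apply {ν : M.InternalProb} {s : Set M.StarPoint}
    (h : MeasurableSet[loebSigmaAlgebra ν] s) : loebMeasure ν s = loebOuterMeasure ν s :=
  @toMeasure_apply M.StarPoint (loebSigmaAlgebra ν) (loebOuterMeasure ν) le_rfl s h

/-- `st⁻¹(A)` is covered by the single internal Borel set `*A`, whose cost is the standard part of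
its measure. -/
theorem le_internalPushDown_of_isOpen [TopologicalSpace X] [OpensMeasurableSpace X]
    {ν : M.InternalProb} {P : Measure X} [IsProbabilityMeasure P] (h : IsExternalPushDown ν P)
    (A : BorelSets X) (hA : IsOpen A.1) :
    (Charge.ofMeasure P).toFun A ≤ (internalPushDown ν).toFun A := by
  refine ENNReal.toReal_le_of_le_ofReal ((internalPushDown ν).nonneg A) ?_
  obtain ⟨hm, he⟩ := h A.1 A.2
  rw [← he, loebMeasure_apply hm]
  refine le_trans ?_ (loebOuterMeasure_extent_le ν (M.starBorel A))
  rw [extent_starBorel]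
  exact measure_mono (stPreimage_subset_starPoints hA)

end PushDown

/-! ### Internal Dirac measures at nonstandard points -/

section InternalDirac

variable {X : Type*} [MeasurableSpace X] {M : NonstandardExtension (StdUniverse X)}

/-- The Dirac charge at the first argument, if that is a point, and at `x` otherwise. -/
def diracMap (x : X) : StdUniverse X → StdUniverse X → StdUniverse X
  | point z, _ => charge (Charge.ofUltrafilter (pure z))
  | _, _ => charge (Charge.ofUltrafilter (pure x))

/-- The complement of the first argument, if that is a point, and the empty set otherwise. -/
def complMap [MeasurableSingletonClass X] : StdUniverse X → StdUniverse X → StdUniverse X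
  | point z, _ => borel ⟨{z}ᶜ, (measurableSet_singleton z).compl⟩
  | _, _ => borel ⟨∅, MeasurableSet.empty⟩

variable (M) in
/-- The internal Dirac measure at a point of `*X`. -/
def internalDirac (x : X) (y : M.StarPoint) : M.InternalProb :=
  ⟨M.starFun (diracMap x) y.1 y.1, by
    rw [starFun_self_mem_starSet]
    refine M.mem_starSet_of_subset (fun u _ => ?_) (M.mem_starSet_univ y.1)
    cases u <;> exact mem_range_self _⟩

variable (M) in
/-- The complement of a point of `*X`. -/
def internalCompl [MeasurableSingletonClass X] (y : M.StarPoint) : M.InternalBorel :=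
  ⟨M.starFun complMap y.1 y.1, by
    rw [starFun_self_mem_starSet]
    refine M.mem_starSet_of_subset (fun u _ => ?_) (M.mem_starSet_univ y.1)
    cases u <;> exact mem_range_self _⟩

theorem value_internalDirac_of_mem (x : X) {y : M.StarPoint} {b : M.InternalBorel}
    (h : y ∈ M.extent b) : value (M.internalDirac x y) b = M.emb (real 1) := by
  refine M.starFun_eq_of_starRel (R := Mem) (fun u v huv => ?_) h
  cases u <;> cases v <;> try exact huv.elim
  exact congrArg real (Charge.ofUltrafilter_of_mem (F := pure _) huv)

theorem value_internalDirac_internalCompl [MeasurableSingletonClass X] (x : X)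
    (y : M.StarPoint) : value (M.internalDirac x y) (M.internalCompl y) = M.emb (real 0) := by
  refine M.starFun_comp_eq (fun u => ?_) y.1
  -- The default values matter: off the points, the complement is the empty set, of Dirac mass 0, so
  -- the identity holds on the whole universe and transfers without a restriction.
  cases u <;> refine congrArg real (Charge.ofUltrafilter_of_notMem ?_) <;>
    simp [Ultrafilter.mem_pure]

theorem mem_extent_internalCompl [MeasurableSingletonClass X] {y a : M.StarPoint} (h : a ≠ y) :
    a ∈ M.extent (M.internalCompl y) := by
  refine M.starRel_of_ne ?_ y.2 a.2 fun e => h (Subtype.ext e.symm)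
  rintro _ ⟨z, rfl⟩ _ ⟨w, rfl⟩ hzw
  exact fun e => hzw (congrArg point e.symm)

/-- In any countable cover some member contains `y`, and that member alone costs 1 if it is internal
Borel and `∞` otherwise. The cover by `*X` costs exactly 1. -/
theorem loebOuterMeasure_internalDirac_of_mem (x : X) {y : M.StarPoint} {s : Set M.StarPoint}
    (h : y ∈ s) : loebOuterMeasure (M.internalDirac x y) s = 1 := by
  refine le_antisymm ?_ ?_
  · have hb : M.extent (M.starBorel (X := X) ⟨univ, MeasurableSet.univ⟩) = univ := by
      rw [extent_starBorel, starPoints_univ]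
    calc loebOuterMeasure (M.internalDirac x y) s
        ≤ loebOuterMeasure (M.internalDirac x y) univ := measure_mono (subset_univ s)
      _ ≤ 1 := by
        rw [← hb]
        refine (loebOuterMeasure_extent_le _ _).trans ?_
        rw [value_internalDirac_of_mem x (hb ▸ mem_univ y), stdPart_emb_real, ENNReal.ofReal_one]
  · rw [loebOuterMeasure, OuterMeasure.ofFunction_apply]
    refine le_iInf₂ fun t ht => ?_
    obtain ⟨n, hn⟩ := mem_iUnion.1 (ht h)
    refine le_trans (le_iInf₂ fun b hb => ?_) (ENNReal.le_tsum n)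
    rw [value_internalDirac_of_mem x (hb ▸ hn), stdPart_emb_real, ENNReal.ofReal_one]

/-- The complement of `{y}` is an internal Borel set of measure 0 that covers `s`. -/
theorem loebOuterMeasure_internalDirac_of_notMem [MeasurableSingletonClass X] (x : X)
    {y : M.StarPoint} {s : Set M.StarPoint} (h : y ∉ s) :
    loebOuterMeasure (M.internalDirac x y) s = 0 := by
  have hs : s ⊆ M.extent (M.internalCompl y) := fun a ha =>
    mem_extent_internalCompl fun e => h (e ▸ ha)
  refine le_antisymm ((measure_mono hs).trans ((loebOuterMeasure_extent_le _ _).trans ?_)) bot_le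
  rw [value_internalDirac_internalCompl, stdPart_emb_real, ENNReal.ofReal_zero]

/-- Every set is Loeb measurable for an internal Dirac measure. -/
theorem measurableSet_loeb_internalDirac [MeasurableSingletonClass X] (x : X)
    (y : M.StarPoint) (s : Set M.StarPoint) :
    MeasurableSet[loebSigmaAlgebra (M.internalDirac x y)] s := by
  refine (OuterMeasure.isCaratheodory_iff_le _).2 fun t => ?_
  by_cases ht : y ∈ t
  · rw [loebOuterMeasure_internalDirac_of_mem x ht]
    by_cases hs : y ∈ s
    · rw [loebOuterMeasure_internalDirac_of_mem x (mem_inter ht hs),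
        loebOuterMeasure_internalDirac_of_notMem x fun h => h.2 hs, add_zero]
    · rw [loebOuterMeasure_internalDirac_of_notMem x fun h => hs h.2,
        loebOuterMeasure_internalDirac_of_mem x (mem_sdiff_of_mem ht hs), zero_add]
  · rw [loebOuterMeasure_internalDirac_of_notMem x fun h => ht h.1,
      loebOuterMeasure_internalDirac_of_notMem x fun h => ht h.1, add_zero]
    exact bot_le

theorem disjoint_starPoints {A B : Set X} (h : Disjoint A B) :
    Disjoint (M.starPoints A) (M.starPoints B) := by
  refine Set.disjoint_left.2 fun a hA hB => ?_
  have hAB := (M.mem_starSet_inter _ _ a.1).2 ⟨hA, hB⟩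
  -- A common point would lie in the star of the empty set.
  rw [← image_inter fun _ _ e => StdUniverse.point.inj e, h.inter_eq, image_empty] at hAB
  exact (M.starUltrafilter a.1).empty_notMem hAB

/-- A point of `*X` is infinitely close to at most one point of a Hausdorff space. -/
theorem mem_stPreimage_iff [TopologicalSpace X] [T2Space X] {x : X} {y : M.StarPoint}
    (hy : y ∈ M.monad x) (C : Set X) : y ∈ M.stPreimage C ↔ x ∈ C := by
  refine ⟨fun h => ?_, fun h => mem_iUnion₂.2 ⟨x, h, hy⟩⟩
  obtain ⟨z, hz, hyz⟩ := mem_iUnion₂.1 h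
  by_contra hx
  obtain ⟨V, W, hV, hW, hxV, hzW, hVW⟩ := t2_separation fun e : x = z => hx (e ▸ hz)
  simp only [monad, mem_iInter] at hy hyz
  exact Set.disjoint_left.1 (disjoint_starPoints hVW) (hy V hV hxV) (hyz W hW hzW)

/-- Since `x` is the only standard point near `y`, the set `st⁻¹(C)` contains `y` exactly when `x ∈
C`. -/
theorem isExternalPushDown_internalDirac [TopologicalSpace X] [T2Space X]
    [MeasurableSingletonClass X] {x : X} {y : M.StarPoint} (hy : y ∈ M.monad x) :
    IsExternalPushDown (M.internalDirac x y) (Measure.dirac x) := by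
  intro C hC
  have hm := measurableSet_loeb_internalDirac x y (M.stPreimage C)
  refine ⟨hm, ?_⟩
  rw [loebMeasure_apply hm, Measure.dirac_apply' x hC]
  by_cases hx : x ∈ C
  · rw [loebOuterMeasure_internalDirac_of_mem x ((mem_stPreimage_iff hy C).2 hx),
      indicator_of_mem hx, Pi.one_apply]
  · rw [loebOuterMeasure_internalDirac_of_notMem x ((mem_stPreimage_iff hy C).not.2 hx),
      indicator_of_notMem hx]

variable (M) in
/-- The monad of a non-isolated point contains points of the star of its complement. -/
theorem exists_mem_monad [PseudoMetricSpace X] (x : X) [(𝓝[≠] x).NeBot] :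
    ∃ y ∈ M.monad x, y ∈ M.starPoints {x}ᶜ := by
  have : Nonempty (StdUniverse X) := ⟨point x⟩
  -- A countable base of punctured neighbourhoods brings the monad within reach of countable
  -- saturation; non-isolation of `x` gives the finite intersection property.
  let A : ℕ → Set X := fun n => Metric.ball x (1 / (n + 1)) ∩ {x}ᶜ
  have hA : ∀ n, A n ∈ 𝓝[≠] x := fun n =>
    Filter.inter_mem (mem_nhdsWithin_of_mem_nhds (Metric.ball_mem_nhds x (by positivity)))
      self_mem_nhdsWithin
  obtain ⟨a, ha⟩ := M.exists_mem_starSet (fun n => point '' A n) fun n => by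
    obtain ⟨z, hz⟩ := Filter.nonempty_of_mem
      ((Filter.biInter_finset_mem (Finset.range n)).2 fun k _ => hA k)
    refine ⟨point z, ?_⟩
    simp only [mem_iInter] at hz ⊢
    exact fun k hk => mem_image_of_mem _ (hz k hk)
  refine ⟨⟨a, M.mem_starSet_of_subset (image_subset_range _ _) (ha 0)⟩, ?_,
    M.mem_starSet_of_subset (image_mono inter_subset_right) (ha 0)⟩
  simp only [monad, mem_iInter]
  intro V hV hxV
  obtain ⟨ε, hε, hball⟩ := Metric.isOpen_iff.1 hV x hxV
  obtain ⟨n, hn⟩ := exists_nat_one_div_lt hε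
  exact M.mem_starSet_of_subset
    (image_mono (inter_subset_left.trans ((Metric.ball_subset_ball hn.le).trans hball))) (ha n)

theorem ofMeasure_dirac_ne_internalPushDown [MeasurableSingletonClass X] {x : X}
    {y : M.StarPoint} (hy : y ∈ M.starPoints {x}ᶜ) :
    Charge.ofMeasure (Measure.dirac x) ≠ internalPushDown (M.internalDirac x y) := by
  intro h
  have h1 := congrFun (congrArg Charge.toFun h) ⟨{x}ᶜ, (measurableSet_singleton x).compl⟩
  have h2 : M.stdPart (value (M.internalDirac x y)
      (M.starBorel ⟨{x}ᶜ, (measurableSet_singleton x).compl⟩)) = 1 := by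
    rw [value_internalDirac_of_mem x (by rwa [extent_starBorel]), stdPart_emb_real]
  have h3 : (Measure.dirac x).real {x}ᶜ = 0 := by simp [Measure.real]
  exact zero_ne_one (h3.symm.trans (h1.trans h2))

end InternalDirac

end NonstandardExtension

end

theorem mainTheorem5 {X : Type*} [MetricSpace X] [MeasurableSpace X] [BorelSpace X]
    [BoundedSpace X] [SigmaCompactSpace X] :
    -- the distance between the two push-downs is zero
    (∀ (M : NonstandardExtension (StdUniverse X)) (ν : M.InternalProb)
        (P : Measure X) [IsProbabilityMeasure P],
      NonstandardExtension.IsExternalPushDown ν P →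
        wasserstein (Charge.ofMeasure P) (NonstandardExtension.internalPushDown ν) = 0) ∧
    -- the Wasserstein distance is a pseudometric on the charges
    ((∀ μ ν : Charge X, wasserstein μ ν ≠ ∞) ∧
      (∀ μ : Charge X, wasserstein μ μ = 0) ∧
      (∀ μ ν : Charge X, wasserstein μ ν = wasserstein ν μ) ∧
      (∀ μ ν ρ : Charge X, wasserstein μ ρ ≤ wasserstein μ ν + wasserstein ν ρ)) ∧
    -- it is not a metric if the space is not discrete, as the two push-downs may differ
    ((∃ x : X, (𝓝[≠] x).NeBot) →
      (∀ M : NonstandardExtension (StdUniverse X),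
        ∃ (ν : M.InternalProb) (P : Measure X) (_ : IsProbabilityMeasure P),
          NonstandardExtension.IsExternalPushDown ν P ∧
            Charge.ofMeasure P ≠ NonstandardExtension.internalPushDown ν) ∧
      ∃ μ ν : Charge X, μ ≠ ν ∧ wasserstein μ ν = 0) := by
 
  refine ⟨fun M ν P _ h => wasserstein_eq_zero_of_le_on_open
      (NonstandardExtension.le_internalPushDown_of_isOpen h),
    ⟨wasserstein_ne_top, wasserstein_self, wasserstein_comm, wasserstein_triangle⟩, ?_⟩
  rintro ⟨x, hx⟩
  refine ⟨fun M => ?_, exists_ne_wasserstein_eq_zero x⟩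
  obtain ⟨y, hy, hyx⟩ := M.exists_mem_monad x
  exact ⟨M.internalDirac x y, Measure.dirac x, inferInstance,
    NonstandardExtension.isExternalPushDown_internalDirac hy,
    NonstandardExtension.ofMeasure_dirac_ne_internalPushDown hyx⟩
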